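/- **Setting.** Write $\mathbb B=\{0,1\}$. An *energy function* with *pivot* $\kappa\in[0,1]$ is a continuously differentiable function $\zeta:[0,1]\to[0,1]$ such that $\zeta'(c)\le 0$ for $c<\kappa$, $\zeta'(c)\ge 0$ for $c>\kappa$, $\zeta(\kappa)=\zeta'(\kappa)=0$, $\zeta(0)>0$ and $\zeta(1)>0$. Let $p\in[0,1]$, and let $(\zeta_q)_{q\in[0,1]}$ be a family of energy functions, $\zeta_q$ having pivot $\kappa_q$. Consider $\mathbb B$-valued random variables $X_1,Y_1,X_2,Y_2,\dots$ (decisions and interventions) on a probability space. Given $X_1,Y_1,\dots,X_{t-1},Y_{t-1}$, the decision $X_t$ is $\mathrm{Bernoulli}(p)$. Put $Z_t=(1-X_t)Y_t+X_t(1-Y_t)$ (the decision $X_t$, flipped if $Y_t=1$), $M_t=\frac1t\sum_{i=1}^t Z_i$ and $\hat p_t=\frac1t\sum_{i=1}^t X_i$. For $t\ge 2$, given $X_1,Y_1,\dots,X_{t-1},Y_{t-1},X_t$, the intervention $Y_t$ is Bernoulli with parameter determined by the energy shield of $\zeta_{\hat p_t}$, namely - if $M_{t-1}\le\kappa_{\hat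 p_t}$: parameter $\zeta_{\hat p_t}(M_{t-1})$ when $X_t=0$, and $0$ when $X_t=1$; - if $M_{t-1}>\kappa_{\hat p_t}$: parameter $\zeta_{\hat p_t}(M_{t-1})$ when $X_t=1$, and $0$ when $X_t=0$. For $t=1$, given $X_1$, the intervention $Y_1$ is Bernoulli with an arbitrary parameter depending only on $X_1$. **Theorem (fixed and unknown $p$).** Let $\mu^*\in[0,1]$. Suppose that for every $q\in[0,1]$ $$\zeta_q(\mu^*)=\begin{cases}(\mu^*-q)/(1-q)&\text{if }q<\mu^*,\\ (q-\mu^*)/q&\text{otherwise,}\end{cases}$$ and that $\mu^*$ lies between $q$ and $\kappa_q$ (that is, $\min(q,\kappa_q)\le\mu^*\le\max(q,\kappa_q)$). Then $M_t\to\mu^*$ almost surely as $t\to\infty$. (The hypotheses force $0<\mu^*<1$, so the denominators do not vanish where they are used.) -/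

import Mathlib

open MeasureTheory Filter Topology Set

namespace EnergyShield

/-- An energy function `[0,1] → [0,1]` together with its pivoting point. The underlying map is stored
as a map on `ℝ`, of which only the restriction to `[0,1]` matters; all derivatives are derivatives
within `[0,1]` (one-sided at the end points). -/
structure EnergyFunction where
  toFun : ℝ → ℝ
  pivot : unitInterval
  mapsTo : MapsTo toFun (Icc 0 1) (Icc 0 1)
  differentiableOn : DifferentiableOn ℝ toFun (Icc 0 1)
  continuousOn_deriv : ContinuousOn (derivWithin toFun (Icc 0 1)) (Icc 0 1)
  deriv_nonpos : ∀ c ∈ Icc (0 : ℝ) 1, c < pivot → derivWithin toFun (Icc 0 1) c ≤ 0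
  deriv_nonneg : ∀ c ∈ Icc (0 : ℝ) 1, (pivot : ℝ) < c → 0 ≤ derivWithin toFun (Icc 0 1) c
  map_pivot : toFun pivot = 0
  deriv_pivot : derivWithin toFun (Icc 0 1) pivot = 0
  pos_zero : 0 < toFun 0
  pos_one : 0 < toFun 1

/-- The energy `ζ(μ) ∈ [0,1]` of a fairness value `μ ∈ [0,1]`. -/
def EnergyFunction.energy (ζ : EnergyFunction) (μ : unitInterval) : unitInterval :=
  ⟨ζ.toFun μ, ζ.mapsTo μ.2⟩

/-- The probability with which the energy shield of `ζ` flips the decision `x` when the current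
fairness value is `μ`: for `μ ≤ κ` the decision `1` is accepted and `0` is flipped with probability
`ζ(μ)`; for `μ > κ` the decision `0` is accepted and `1` is flipped with probability `ζ(μ)`. -/
noncomputable def EnergyFunction.flipProb (ζ : EnergyFunction) (μ : unitInterval) (x : Bool) :
    unitInterval :=
  if μ ≤ ζ.pivot then
    (if x = true then 0 else ζ.energy μ)
  else
    (if x = true then ζ.energy μ else 0)

/-- The average of a finite sequence of binary decisions (`0` for the empty sequence). -/
noncomputable def avgDecision (l : List Bool) : unitInterval :=
  ⟨(l.count true : ℝ) / l.length, by positivity,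
    div_le_one_of_le₀ (by exact_mod_cast List.count_le_length) (by positivity)⟩

/-- The released decision `(1 - x) y + x (1 - y)`: the decision `x`, flipped if `y = 1`. -/
def release (x y : Bool) : Bool := if y = true then !x else x

/-- A probabilistic shield: it maps the past pairs (decision, intervention) and the current decision
to the probability of flipping the current decision. -/
abbrev ProbabilisticShield := List (Bool × Bool) → Bool → unitInterval

/-- The adaptive energy shield of a family `(ζ_q)`. At a time `t ≥ 2`, with past
`(x₁, y₁), …, (x_{t-1}, y_{t-1})` and current decision `x_t`, it uses the energy function `ζ_q` with
`q = p̂_t` the average of `x₁, …, x_t`, at the current fairness value, that is the average of the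
released decisions `z₁, …, z_{t-1}`. At time `1` there is no fairness value yet, and the probability of
flipping the decision `x₁` is a parameter `first x₁`. -/
noncomputable def adaptiveShield (ζ : unitInterval → EnergyFunction) (first : Bool → unitInterval) :
    ProbabilisticShield := fun h x =>
  if h = [] then first x
  else (ζ (avgDecision (h.map (fun e => e.1) ++ [x]))).flipProb
    (avgDecision (h.map (fun e => release e.1 e.2))) x

variable {Ω : Type*}

/-- The first `t` pairs (decision, intervention); `X i`, `Y i` are those of time `i + 1`. -/
def history (X Y : ℕ → Ω → Bool) (t : ℕ) (ω : Ω) : List (Bool × Bool) :=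
  (List.range t).map (fun i => (X i ω, Y i ω))

/-- The shielded fairness value `M_t`: the average of the first `t` released decisions. -/
noncomputable def fairness (X Y : ℕ → Ω → Bool) (t : ℕ) (ω : Ω) : ℝ :=
  avgDecision ((history X Y t ω).map (fun e => release e.1 e.2))

/-- `X` is a sequence of tosses of a coin of bias `p` and `Y` is the sequence of interventions of the
shield `S`: given the past, the next decision is `Bernoulli(p)`, and given the past and the current
decision, the intervention is Bernoulli with the probability that the shield prescribes. -/
structure IsShieldedProcess [MeasurableSpace Ω] (P : Measure Ω) (p : unitInterval)
    (S : ProbabilisticShield) (X Y : ℕ → Ω → Bool) : Prop where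
  measurable_decision : ∀ t, Measurable (X t)
  measurable_intervention : ∀ t, Measurable (Y t)
  decision_law : ∀ (t : ℕ) (h : List (Bool × Bool)),
    P.real {ω | history X Y t ω = h ∧ X t ω = true} = p * P.real {ω | history X Y t ω = h}
  intervention_law : ∀ (t : ℕ) (h : List (Bool × Bool)) (x : Bool),
    P.real {ω | history X Y t ω = h ∧ X t ω = x ∧ Y t ω = true} =
      S h x * P.real {ω | history X Y t ω = h ∧ X t ω = x}

end EnergyShield

/-! Given the past, the shield releases `1` with a probability `e_t`, and `M_t` moves towards `e_t`
up to noise. Suppose the decisions are Bernoulli(q) and the shield uses the flip probabilities that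
the formula for `ζ_q(μ*)` prescribes at the value `μ*`. Then the released decision has mean exactly
`μ*` (`targetFlip_balance`). The pivot condition and the monotonicity of `ζ_q` on each side of its
pivot show that the true flip probabilities push further up when `M ≤ μ*` and further down when `M ≥
μ*`.

The shield only knows the empirical bias, so the reference probability `d_t` mixes the true `p` with
target flips at the estimate. The strong law for the decisions and continuity in `q` give `d_t →
μ*`. Hence `e_t ≥ d_t` when `M_t ≤ μ*` and `e_t ≤ d_t` when `M_t ≥ μ*`.

The differences between released decisions and `e_t` are bounded and orthogonal to the past, so
their averages tend to `0` almost surely (`ae_tendsto_average_sub`). The rest is deterministic: such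
a drift with sublinear noise forces convergence (`tendsto_average_of_drift`). -/

namespace EnergyShield

/-! ### Deterministic convergence under a restoring drift -/

section Deterministic

/-- Last-exit argument: right after the last time the average exceeded `m`, the sum is within a
constant of `m` times the time. From then on the drift is almost `m`, and the noise over the
remaining stretch is sublinear. -/
lemma eventually_le_average_of_drift {z e d : ℕ → ℝ} {m : ℝ} (hz : ∀ i, 0 ≤ z i)
    (hm1 : m ≤ 1) (hd : Tendsto d atTop (𝓝 m))
    (hlow : ∀ t, 1 ≤ t → (∑ i ∈ Finset.range t, z i) / t ≤ m → d t ≤ e t)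
    (hW : Tendsto (fun t : ℕ => (∑ i ∈ Finset.range t, (z i - e i)) / t) atTop (𝓝 0))
    {ε : ℝ} (hε : 0 < ε) :
    ∀ᶠ t : ℕ in atTop, m - ε < (∑ i ∈ Finset.range t, z i) / t := by
  -- Four errors, each at most `δ n`, are incurred: the constant `N + 1`, the drift deficit, and the
  -- noise at the times `n` and `s`.
  set δ := ε / 4 with hδ
  have hδ0 : 0 < δ := by positivity
  have h1 : ∀ᶠ t : ℕ in atTop, m - δ < d t := hd.eventually (lt_mem_nhds (by linarith))
  have h2 : ∀ᶠ t : ℕ in atTop, |(∑ i ∈ Finset.range t, (z i - e i)) / t| < δ := by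
    have := hW.abs
    rw [abs_zero] at this
    exact this.eventually (gt_mem_nhds hδ0)
  obtain ⟨N, hN⟩ := eventually_atTop.1 ((h1.and h2).and (eventually_ge_atTop 1))
  set A : ℕ → ℝ := fun t => ∑ i ∈ Finset.range t, z i with hA
  set W : ℕ → ℝ := fun t => ∑ i ∈ Finset.range t, (z i - e i) with hWdef
  have hA0 : ∀ t, 0 ≤ A t := fun t => Finset.sum_nonneg fun i _ => hz i
  have hAs : ∀ t, A (t + 1) = A t + z t := fun t => Finset.sum_range_succ _ _
  have hWs : ∀ t, W (t + 1) = W t + (z t - e t) := fun t => Finset.sum_range_succ _ _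
  have hWb : ∀ t ≥ N, |W t| ≤ δ * t := by
    intro t ht
    have ht1 : (0 : ℝ) < t := by exact_mod_cast (hN t ht).2
    have := (hN t ht).1.2
    rw [abs_div, abs_of_pos ht1, div_lt_iff₀ ht1] at this
    exact this.le
  -- Here `s` is the time just after the last excess over `m`, or `N` if there was none. The
  -- constant `N + 1` covers both the start, where `A N ≥ 0 ≥ N m - N`, and a restart, where one
  -- step costs at most `m ≤ 1`.
  have key : ∀ n ≥ N, ∃ s, N ≤ s ∧ s ≤ n ∧
      s * m - (N + 1) + ((n : ℝ) - s) * (m - δ) + W n - W s ≤ A n := by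
    intro n hn
    induction n, hn using Nat.le_induction with
    | base =>
      refine ⟨N, le_rfl, le_rfl, ?_⟩
      have : (N : ℝ) * m ≤ N := mul_le_of_le_one_right (by positivity) hm1
      have := hA0 N
      linarith
    | succ n hn ih =>
      have hn1 : (0 : ℝ) < n := by exact_mod_cast (hN n hn).2
      by_cases hM : A n / n ≤ m
      · obtain ⟨s, hs, hsn, h⟩ := ih
        refine ⟨s, hs, hsn.trans n.le_succ, ?_⟩
        have h3 := hlow n (hN n hn).2 hM
        have h4 := (hN n hn).1.1
        rw [hAs, hWs]
        push_cast
        linarith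
      · refine ⟨n + 1, by omega, le_rfl, ?_⟩
        rw [not_le, lt_div_iff₀ hn1] at hM
        rw [hAs]
        have := hz n
        have : (0 : ℝ) ≤ N := by positivity
        push_cast
        linarith
  have hlarge : ∀ᶠ n : ℕ in atTop, ((N : ℝ) + 1) / δ < n :=
    tendsto_natCast_atTop_atTop.eventually_gt_atTop _
  filter_upwards [hlarge, eventually_ge_atTop N] with n hn1 hn2
  have hn0 : (0 : ℝ) < n := by exact_mod_cast (hN n hn2).2
  obtain ⟨s, hs, hsn, h⟩ := key n hn2
  rw [lt_div_iff₀ hn0]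
  rw [div_lt_iff₀ hδ0] at hn1
  have h5 := (abs_le.1 (hWb n hn2)).1
  have h6 := (abs_le.1 (hWb s hs)).2
  have hsn' : (s : ℝ) ≤ n := by exact_mod_cast hsn
  have h7 : δ * s ≤ δ * n := by gcongr
  have h8 : 0 ≤ δ * s := by positivity
  have h9 : ε = 4 * δ := by rw [hδ]; ring
  rw [h9]
  change _ < A n
  linarith

/-- An average of `[0,1]`-valued increments whose compensators push it towards `m`, up to a vanishing
error, converges to `m`, provided that the compensated sum is sublinear. -/
lemma tendsto_average_of_drift {z e d : ℕ → ℝ} {m : ℝ} (hz0 : ∀ i, 0 ≤ z i) (hz1 : ∀ i, z i ≤ 1)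
    (hm0 : 0 ≤ m) (hm1 : m ≤ 1) (hd : Tendsto d atTop (𝓝 m))
    (hlow : ∀ t, 1 ≤ t → (∑ i ∈ Finset.range t, z i) / t ≤ m → d t ≤ e t)
    (hhigh : ∀ t, 1 ≤ t → m ≤ (∑ i ∈ Finset.range t, z i) / t → e t ≤ d t)
    (hW : Tendsto (fun t : ℕ => (∑ i ∈ Finset.range t, (z i - e i)) / t) atTop (𝓝 0)) :
    Tendsto (fun t : ℕ => (∑ i ∈ Finset.range t, z i) / t) atTop (𝓝 m) := by
  have hcompl : ∀ t : ℕ, 1 ≤ t →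
      (∑ i ∈ Finset.range t, (1 - z i)) / t = 1 - (∑ i ∈ Finset.range t, z i) / t := by
    intro t ht
    have : (t : ℝ) ≠ 0 := by positivity
    rw [Finset.sum_sub_distrib]
    simp [sub_div, this]
  rw [tendsto_order]
  constructor
  · intro a ha
    simpa using eventually_le_average_of_drift hz0 hm1 hd hlow hW (sub_pos.2 ha)
  · intro a ha
    -- The upper bound is the lower bound after the reflection `x ↦ 1 - x`.
    have := eventually_le_average_of_drift (z := fun i => 1 - z i) (e := fun i => 1 - e i)
      (d := fun i => 1 - d i) (m := 1 - m) (fun i => sub_nonneg.2 (hz1 i))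
      (by linarith) (hd.const_sub 1)
      (fun t ht h => by
        rw [hcompl t ht] at h
        have := hhigh t ht (by linarith)
        linarith)
      (by
        have := hW.neg
        rw [neg_zero] at this
        refine this.congr fun t => ?_
        rw [← neg_div, ← Finset.sum_neg_distrib]
        congr 1
        exact Finset.sum_congr rfl fun i _ => by ring)
      (sub_pos.2 ha)
    filter_upwards [this, eventually_ge_atTop 1] with t ht ht1
    rw [hcompl t ht1] at ht
    linarith

end Deterministic

/-! ### Flip probabilities compared with their targets -/

section Energy

lemma EnergyFunction.antitoneOn (ζ : EnergyFunction) :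
    AntitoneOn ζ.toFun (Icc 0 (ζ.pivot : ℝ)) := by
  have hsub : Icc 0 (ζ.pivot : ℝ) ⊆ Icc 0 1 := Icc_subset_Icc_right ζ.pivot.2.2
  refine antitoneOn_of_deriv_nonpos (convex_Icc _ _) (ζ.differentiableOn.continuousOn.mono hsub)
    ((ζ.differentiableOn.mono hsub).mono interior_subset) fun x hx => ?_
  rw [interior_Icc] at hx
  have hx1 : x < 1 := hx.2.trans_le ζ.pivot.2.2
  rw [← derivWithin_of_mem_nhds (Icc_mem_nhds hx.1 hx1)]
  exact ζ.deriv_nonpos x ⟨hx.1.le, hx1.le⟩ hx.2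

lemma EnergyFunction.monotoneOn (ζ : EnergyFunction) :
    MonotoneOn ζ.toFun (Icc (ζ.pivot : ℝ) 1) := by
  have hsub : Icc (ζ.pivot : ℝ) 1 ⊆ Icc 0 1 := Icc_subset_Icc_left ζ.pivot.2.1
  refine monotoneOn_of_deriv_nonneg (convex_Icc _ _) (ζ.differentiableOn.continuousOn.mono hsub)
    ((ζ.differentiableOn.mono hsub).mono interior_subset) fun x hx => ?_
  rw [interior_Icc] at hx
  have hx0 : 0 < x := ζ.pivot.2.1.trans_lt hx.1
  rw [← derivWithin_of_mem_nhds (Icc_mem_nhds hx0 hx.2)]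
  exact ζ.deriv_nonneg x ⟨hx0.le, hx.2.le⟩ hx.1

lemma EnergyFunction.energy_anti (ζ : EnergyFunction) {a b : unitInterval} (hab : a ≤ b)
    (hb : b ≤ ζ.pivot) : (ζ.energy b : ℝ) ≤ ζ.energy a :=
  ζ.antitoneOn ⟨a.2.1, hab.trans hb⟩ ⟨b.2.1, hb⟩ hab

lemma EnergyFunction.energy_mono (ζ : EnergyFunction) {a b : unitInterval} (hab : a ≤ b)
    (ha : ζ.pivot ≤ a) : (ζ.energy a : ℝ) ≤ ζ.energy b :=
  ζ.monotoneOn ⟨ha, a.2.2⟩ ⟨ha.trans hab, b.2.2⟩ hab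

lemma EnergyFunction.energy_pivot (ζ : EnergyFunction) : (ζ.energy ζ.pivot : ℝ) = 0 := ζ.map_pivot

/-- The flipping probability of the decision `1` at the fairness value `m` that the shield for the
target value `m` uses when the average decision is `q`: `(q - m) / q` if `m ≤ q` and `0` otherwise. -/
noncomputable def targetFlipTrue (m q : ℝ) : ℝ := 1 - m / max q m

/-- The flipping probability of the decision `0` at the fairness value `m` that the shield for the
target value `m` uses when the average decision is `q`: `(m - q) / (1 - q)` if `q ≤ m` and `0`
otherwise. -/
noncomputable def targetFlipFalse (m q : ℝ) : ℝ := 1 - (1 - m) / max (1 - q) (1 - m)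

lemma targetFlipTrue_of_le {m q : ℝ} (hm : 0 < m) (h : q ≤ m) : targetFlipTrue m q = 0 := by
  rw [targetFlipTrue, max_eq_right h, div_self hm.ne', sub_self]

lemma targetFlipTrue_of_ge {m q : ℝ} (hm : 0 < m) (h : m ≤ q) :
    targetFlipTrue m q = (q - m) / q := by
  have : q ≠ 0 := (hm.trans_le h).ne'
  rw [targetFlipTrue, max_eq_left h, sub_div, div_self this]

lemma targetFlipFalse_of_ge {m q : ℝ} (hm : m < 1) (h : m ≤ q) : targetFlipFalse m q = 0 := by
  rw [targetFlipFalse, max_eq_right (by linarith), div_self (by linarith), sub_self]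

lemma targetFlipFalse_of_le {m q : ℝ} (hm : m < 1) (h : q ≤ m) :
    targetFlipFalse m q = (m - q) / (1 - q) := by
  have : 1 - q ≠ 0 := by linarith
  rw [targetFlipFalse, max_eq_left (by linarith)]
  field_simp
  ring

lemma targetFlipTrue_nonneg {m q : ℝ} (hm : 0 < m) : 0 ≤ targetFlipTrue m q :=
  sub_nonneg.2 (div_le_one_of_le₀ (le_max_right _ _) (hm.le.trans (le_max_right _ _)))

lemma targetFlipFalse_nonneg {m q : ℝ} (hm : m < 1) : 0 ≤ targetFlipFalse m q :=
  sub_nonneg.2 (div_le_one_of_le₀ (le_max_right _ _)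
    ((sub_nonneg.2 hm.le).trans (le_max_right _ _)))

/-- The `max` in the definition keeps the denominator at least `m`, so the two regimes glue
continuously in `q`. -/
lemma continuous_targetFlipTrue {m : ℝ} (hm : 0 < m) : Continuous (targetFlipTrue m) :=
  continuous_const.sub (continuous_const.div (continuous_id.max continuous_const)
    fun _ => (hm.trans_le (le_max_right _ _)).ne')

lemma continuous_targetFlipFalse {m : ℝ} (hm : m < 1) : Continuous (targetFlipFalse m) :=
  continuous_const.sub (continuous_const.div
    ((continuous_const.sub continuous_id).max continuous_const)
    fun _ => ((sub_pos.2 hm).trans_le (le_max_right _ _)).ne')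

lemma targetFlip_balance {m q : ℝ} (hm0 : 0 < m) (hm1 : m < 1) :
    q * (1 - targetFlipTrue m q) + (1 - q) * targetFlipFalse m q = m := by
  rcases le_total q m with h | h
  · have : 1 - q ≠ 0 := by linarith
    rw [targetFlipTrue_of_le hm0 h, targetFlipFalse_of_le hm1 h]
    field_simp
    ring
  · have : q ≠ 0 := (hm0.trans_le h).ne'
    rw [targetFlipTrue_of_ge hm0 h, targetFlipFalse_of_ge hm1 h]
    field_simp
    ring

variable {ζ : EnergyFunction} {m q μ : unitInterval}

/-- Decision `1` can be flipped only when `κ < μ ≤ m`. Since `m` lies between `q` and `κ`, this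
forces `m ≤ q`, and `ζ` increases to the right of `κ`. This and the next three lemmas give the
direction of the drift. -/
lemma flipProb_true_le (hm0 : (0 : ℝ) < m)
    (hζ : (ζ.energy m : ℝ) = if q < m then ((m : ℝ) - q) / (1 - q) else ((q : ℝ) - m) / q)
    (hpivot : m ∈ Set.uIcc q ζ.pivot) (hμ : μ ≤ m) :
    (ζ.flipProb μ true : ℝ) ≤ targetFlipTrue m q := by
  by_cases h : μ ≤ ζ.pivot
  · simpa [EnergyFunction.flipProb, h] using targetFlipTrue_nonneg hm0
  · rw [not_le] at h
    have hmq : m ≤ q := by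
      rcases Set.mem_uIcc.1 hpivot with h' | h'
      · exact absurd (h'.2.trans_lt h) hμ.not_gt
      · exact h'.2
    rw [if_neg hmq.not_gt] at hζ
    rw [targetFlipTrue_of_ge hm0 hmq, ← hζ]
    simpa [EnergyFunction.flipProb, h.not_ge] using ζ.energy_mono hμ h.le

lemma le_flipProb_true (hm0 : (0 : ℝ) < m)
    (hζ : (ζ.energy m : ℝ) = if q < m then ((m : ℝ) - q) / (1 - q) else ((q : ℝ) - m) / q)
    (hpivot : m ∈ Set.uIcc q ζ.pivot) (hμ : m ≤ μ) :
    targetFlipTrue m q ≤ ζ.flipProb μ true := by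
  rcases le_or_gt q m with h | h
  · rw [targetFlipTrue_of_le hm0 h]
    exact (ζ.flipProb μ true).2.1
  · have hκ : ζ.pivot ≤ m := by
      rcases Set.mem_uIcc.1 hpivot with h' | h'
      · exact absurd h'.1 h.not_ge
      · exact h'.1
    rw [if_neg h.le.not_gt] at hζ
    have hpos : (0 : ℝ) < (q - m) / q :=
      div_pos (sub_pos.2 h) (hm0.trans h)
    -- Strictness matters: at `μ = κ` the shield accepts `1`. It holds because the energy vanishes
    -- at the pivot but is positive at `m`.
    have hκ' : ζ.pivot < m := by
      refine lt_of_le_of_ne hκ fun h' => ?_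
      rw [← hζ, ← h', ζ.energy_pivot] at hpos
      exact hpos.false
    rw [targetFlipTrue_of_ge hm0 h.le, ← hζ]
    simpa [EnergyFunction.flipProb, (hκ'.trans_le hμ).not_ge] using ζ.energy_mono hμ hκ

lemma le_flipProb_false (hm1 : (m : ℝ) < 1)
    (hζ : (ζ.energy m : ℝ) = if q < m then ((m : ℝ) - q) / (1 - q) else ((q : ℝ) - m) / q)
    (hpivot : m ∈ Set.uIcc q ζ.pivot) (hμ : μ ≤ m) :
    targetFlipFalse m q ≤ ζ.flipProb μ false := by
  rcases le_or_gt m q with h | h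
  · rw [targetFlipFalse_of_ge hm1 h]
    exact (ζ.flipProb μ false).2.1
  · have hκ : m ≤ ζ.pivot := by
      rcases Set.mem_uIcc.1 hpivot with h' | h'
      · exact h'.2
      · exact absurd h'.2 h.not_ge
    rw [if_pos h] at hζ
    rw [targetFlipFalse_of_le hm1 h.le, ← hζ]
    simpa [EnergyFunction.flipProb, hμ.trans hκ] using ζ.energy_anti hμ hκ

lemma flipProb_false_le (hm1 : (m : ℝ) < 1)
    (hζ : (ζ.energy m : ℝ) = if q < m then ((m : ℝ) - q) / (1 - q) else ((q : ℝ) - m) / q)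
    (hpivot : m ∈ Set.uIcc q ζ.pivot) (hμ : m ≤ μ) :
    (ζ.flipProb μ false : ℝ) ≤ targetFlipFalse m q := by
  by_cases h : μ ≤ ζ.pivot
  · have hle : (ζ.flipProb μ false : ℝ) ≤ ζ.energy m := by
      simpa [EnergyFunction.flipProb, h] using ζ.energy_anti hμ h
    refine hle.trans ?_
    rcases lt_or_ge q m with hq | hq
    · rw [targetFlipFalse_of_le hm1 hq.le, hζ, if_pos hq]
    -- The target is `0` here, and `ζ(m) = 0` as well: either `q = m`, or `κ ≤ m ≤ μ ≤ κ` makes `m`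
    -- the pivot.
    · rw [targetFlipFalse_of_ge hm1 hq]
      rcases Set.mem_uIcc.1 hpivot with h' | h'
      · rw [hζ, if_neg hq.not_gt, le_antisymm h'.1 hq, sub_self, zero_div]
      · rw [le_antisymm (hμ.trans h) h'.1, ζ.energy_pivot]
  · simpa [EnergyFunction.flipProb, h] using targetFlipFalse_nonneg hm1

/-- If `m = 0`, taking `q = 1` forces the pivot to be `0`, where the energy is `0`, yet the formula
gives `1`. The case `m = 1` is symmetric, with `q = 0`. -/
lemma target_mem_Ioo {ζ : unitInterval → EnergyFunction}
    (hζ : ∀ q : unitInterval, ((ζ q).energy m : ℝ) =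
      if q < m then ((m : ℝ) - q) / (1 - q) else ((q : ℝ) - m) / q)
    (hpivot : ∀ q : unitInterval, m ∈ Set.uIcc q (ζ q).pivot) : (m : ℝ) ∈ Ioo (0 : ℝ) 1 := by
  refine ⟨unitInterval.pos_iff_ne_zero.2 ?_, unitInterval.lt_one_iff_ne_one.2 ?_⟩
  · rintro rfl
    have h := hζ 1
    have hp := hpivot 1
    have : (ζ 1).pivot = 0 := by
      rcases Set.mem_uIcc.1 hp with h' | h'
      · exact absurd h'.1 (by simp)
      · exact le_antisymm h'.1 unitInterval.nonneg'
    rw [← this, (ζ 1).energy_pivot, this] at h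
    simp at h
  · rintro rfl
    have h := hζ 0
    have hp := hpivot 0
    have : (ζ 0).pivot = 1 := by
      rcases Set.mem_uIcc.1 hp with h' | h'
      · exact le_antisymm unitInterval.le_one' h'.2
      · exact absurd h'.2 (by simp)
    rw [← this, (ζ 0).energy_pivot, this] at h
    simp at h

end Energy

/-! ### A strong law for bounded orthogonal increments -/

section StrongLaw

variable {Ω : Type*} [MeasurableSpace Ω] {P : Measure Ω} [IsProbabilityMeasure P]

/-- Expanding the square of the next partial sum, the cross term integrates to zero and the new
square adds at most `1`. -/
lemma integral_sum_sq_le {D : ℕ → Ω → ℝ} (hmeas : ∀ n, Measurable (D n))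
    (hbound : ∀ n ω, |D n ω| ≤ 1)
    (horth : ∀ n, ∫ ω, (∑ i ∈ Finset.range n, D i ω) * D n ω ∂P = 0) (n : ℕ) :
    ∫ ω, (∑ i ∈ Finset.range n, D i ω) ^ 2 ∂P ≤ n := by
  have hSm : ∀ n, Measurable fun ω => ∑ i ∈ Finset.range n, D i ω := fun n =>
    Finset.measurable_fun_sum _ fun i _ => hmeas i
  have hSb : ∀ n ω, |∑ i ∈ Finset.range n, D i ω| ≤ n := fun n ω =>
    (Finset.abs_sum_le_sum_abs _ _).trans
      ((Finset.sum_le_sum fun i _ => hbound i ω).trans (by simp))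
  induction n with
  | zero => simp
  | succ n ih =>
    have i1 : Integrable (fun ω => (∑ i ∈ Finset.range n, D i ω) ^ 2) P :=
      Integrable.of_bound ((hSm n).pow_const 2).aestronglyMeasurable ((n : ℝ) ^ 2)
        (ae_of_all _ fun ω => by
          rw [Real.norm_eq_abs, abs_pow]
          exact pow_le_pow_left₀ (abs_nonneg _) (hSb n ω) 2)
    have i2 : Integrable (fun ω => 2 * ((∑ i ∈ Finset.range n, D i ω) * D n ω)) P :=
      (Integrable.of_bound ((hSm n).mul (hmeas n)).aestronglyMeasurable (n : ℝ)
        (ae_of_all _ fun ω => by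
          rw [Real.norm_eq_abs, Pi.mul_apply, abs_mul]
          exact (mul_le_mul (hSb n ω) (hbound n ω) (abs_nonneg _) (by positivity)).trans
            (mul_one _).le)).const_mul 2
    have hle : ∀ ω, (D n ω) ^ 2 ≤ 1 := fun ω => (sq_le_one_iff_abs_le_one _).2 (hbound n ω)
    have i3 : Integrable (fun ω => (D n ω) ^ 2) P :=
      Integrable.of_bound ((hmeas n).pow_const 2).aestronglyMeasurable 1
        (ae_of_all _ fun ω => by
          rw [Real.norm_eq_abs, abs_of_nonneg (sq_nonneg _)]
          exact hle ω)
    have h3 : ∫ ω, (D n ω) ^ 2 ∂P ≤ 1 := by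
      simpa using integral_mono i3 (integrable_const 1) hle
    have heq : ∀ ω, (∑ i ∈ Finset.range (n + 1), D i ω) ^ 2 =
        (∑ i ∈ Finset.range n, D i ω) ^ 2 + 2 * ((∑ i ∈ Finset.range n, D i ω) * D n ω) +
          (D n ω) ^ 2 := fun ω => by
      rw [Finset.sum_range_succ]
      ring
    simp_rw [heq]
    rw [integral_add (by exact i1.add i2) i3, integral_add i1 i2, integral_const_mul, horth n]
    push_cast
    linarith

/-- A strong law of large numbers for bounded orthogonal increments. -/
lemma ae_tendsto_average_zero {D : ℕ → Ω → ℝ} (hmeas : ∀ n, Measurable (D n))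
    (hbound : ∀ n ω, |D n ω| ≤ 1)
    (horth : ∀ n, ∫ ω, (∑ i ∈ Finset.range n, D i ω) * D n ω ∂P = 0) :
    ∀ᵐ ω ∂P, Tendsto (fun n : ℕ => (∑ i ∈ Finset.range n, D i ω) / n) atTop (𝓝 0) := by
  have hSm : ∀ n, Measurable fun ω => ∑ i ∈ Finset.range n, D i ω := fun n =>
    Finset.measurable_fun_sum _ fun i _ => hmeas i
  have hSb : ∀ n ω, |∑ i ∈ Finset.range n, D i ω| ≤ n := fun n ω =>
    (Finset.abs_sum_le_sum_abs _ _).trans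
      ((Finset.sum_le_sum fun i _ => hbound i ω).trans (by simp))
  -- Along squares the second moments of the averages are at most `1 / (n + 1) ^ 2`, hence summable,
  -- which gives almost sure convergence on this subsequence.
  set c : ℕ → ℕ := fun n => (n + 1) ^ 2 with hc
  set F : ℕ → Ω → ℝ := fun n ω => ((∑ i ∈ Finset.range (c n), D i ω) / c n) ^ 2 with hF
  have hFm : ∀ n, Measurable (F n) := fun n => ((hSm (c n)).div_const _).pow_const 2
  have hFi : ∀ n, Integrable (F n) P := fun n =>
    Integrable.of_bound (hFm n).aestronglyMeasurable 1 (ae_of_all _ fun ω => by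
      rw [Real.norm_eq_abs, abs_pow, abs_div, Nat.abs_cast]
      exact pow_le_one₀ (by positivity) (div_le_one_of_le₀ (hSb _ _) (by positivity)))
  have hFint : ∀ n, ∫ ω, F n ω ∂P ≤ 1 / ((n + 1 : ℕ) : ℝ) ^ 2 := by
    intro n
    have h := integral_sum_sq_le hmeas hbound horth (c n)
    have hcpos : (0 : ℝ) < c n := by simp only [hc]; positivity
    simp only [hF, div_pow]
    rw [integral_div, div_le_iff₀ (by positivity)]
    refine h.trans (le_of_eq ?_)
    simp only [hc]
    push_cast
    field_simp
  have hsum : Summable fun n : ℕ => 1 / ((n + 1 : ℕ) : ℝ) ^ 2 :=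
    (summable_nat_add_iff 1).2 (Real.summable_one_div_nat_pow.2 one_lt_two)
  have hfin : ∫⁻ ω, ∑' n, ENNReal.ofReal (F n ω) ∂P ≠ ⊤ := by
    rw [lintegral_tsum fun n => (hFm n).ennreal_ofReal.aemeasurable]
    refine ne_top_of_le_ne_top hsum.tsum_ofReal_ne_top (ENNReal.tsum_le_tsum fun n => ?_)
    rw [← ofReal_integral_eq_lintegral_ofReal (hFi n) (ae_of_all _ fun ω => sq_nonneg _)]
    exact ENNReal.ofReal_le_ofReal (hFint n)
  filter_upwards [ae_lt_top (Measurable.tsum fun n => (hFm n).ennreal_ofReal) hfin] with ω hω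
  have hF0 : Tendsto (fun n => F n ω) atTop (𝓝 0) := by
    have := (ENNReal.tendsto_toReal ENNReal.zero_ne_top).comp
      (ENNReal.tendsto_atTop_zero_of_tsum_ne_top hω.ne)
    refine this.congr fun n => ?_
    exact ENNReal.toReal_ofReal (sq_nonneg _)
  have hsub : Tendsto (fun n => (∑ i ∈ Finset.range (c n), D i ω) / c n) atTop (𝓝 0) := by
    have := hF0.sqrt
    rw [Real.sqrt_zero] at this
    refine tendsto_zero_iff_abs_tendsto_zero _ |>.2 (this.congr fun n => ?_)
    exact Real.sqrt_sq_eq_abs _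
  have hctop : Tendsto c atTop atTop :=
    tendsto_atTop_mono (fun n => by simp only [hc, id]; nlinarith) tendsto_id
  -- Adding `n` makes the partial sums monotone, as increments are at least `-1`. Consecutive
  -- squares have ratio tending to `1`, so the limit, shifted to `1`, extends to all times.
  have hmain := tendsto_div_of_monotone_of_exists_subseq_tendsto_div
    (fun n => ∑ i ∈ Finset.range n, D i ω + n) 1
    (monotone_nat_of_le_succ fun n => by
      rw [Finset.sum_range_succ]
      push_cast
      linarith [(abs_le.1 (hbound n ω)).1])
    (fun a ha => ⟨c, by
      -- If `(a - 1) n ≥ 3`, then `(a - 1) (n + 1) ^ 2 ≥ 3 (n + 1) ≥ 2 n + 3`, the gap between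
      -- consecutive squares.
      filter_upwards [tendsto_natCast_atTop_atTop.eventually_ge_atTop (3 / (a - 1))] with n hn
      rw [div_le_iff₀ (by linarith)] at hn
      simp only [hc]
      push_cast
      have hn0 : (0 : ℝ) ≤ n := by positivity
      nlinarith, hctop, by
      have := hsub.add_const 1
      rw [zero_add] at this
      refine this.congr fun n => ?_
      have : (c n : ℝ) ≠ 0 := by simp only [hc]; positivity
      field_simp⟩)
  have := hmain.sub_const 1
  rw [sub_self] at this
  refine this.congr' ?_
  filter_upwards [eventually_ge_atTop 1] with n hn
  have : (n : ℝ) ≠ 0 := by positivity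
  field_simp
  ring

end StrongLaw

/-! ### From laws given the history to orthogonality -/

section History

variable {Ω : Type*} {X Y : ℕ → Ω → Bool}

lemma history_eq_ofFn (t : ℕ) (ω : Ω) :
    history X Y t ω = List.ofFn fun i : Fin t => (X i ω, Y i ω) := by
  rw [history, List.ofFn_eq_map, ← List.map_coe_finRange_eq_range, List.map_map]
  rfl

lemma history_length (t : ℕ) (ω : Ω) : (history X Y t ω).length = t := by
  simp [history]

lemma history_take {s t : ℕ} (hst : s ≤ t) (ω : Ω) :
    (history X Y t ω).take s = history X Y s ω := by
  rw [history, ← List.map_take, List.take_range, min_eq_left hst, history]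

variable [MeasurableSpace Ω] {P : Measure Ω} [IsProbabilityMeasure P]

lemma measurable_comp_history (hX : ∀ t, Measurable (X t)) (hY : ∀ t, Measurable (Y t)) (t : ℕ)
    (ψ : List (Bool × Bool) → ℝ) : Measurable fun ω => ψ (history X Y t ω) := by
  have hg : Measurable fun ω => fun i : Fin t => (X i ω, Y i ω) :=
    measurable_pi_lambda _ fun i => (hX i).prodMk (hY i)
  simp_rw [history_eq_ofFn]
  exact (measurable_of_finite fun v : Fin t → Bool × Bool => ψ (List.ofFn v)).comp hg

/-- If `B` is Bernoulli with parameter `e h` given the history `h`, then `B - e` is orthogonal to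
every function of the history. -/
lemma integral_comp_history_mul_sub (hX : ∀ t, Measurable (X t)) (hY : ∀ t, Measurable (Y t))
    (t : ℕ) {B : Ω → Bool} (hB : Measurable B) {e : List (Bool × Bool) → ℝ}
    (hlaw : ∀ h, P.real {ω | history X Y t ω = h ∧ B ω = true} =
      e h * P.real {ω | history X Y t ω = h}) (ψ : List (Bool × Bool) → ℝ) :
    ∫ ω, ψ (history X Y t ω) * (((B ω).toNat : ℝ) - e (history X Y t ω)) ∂P = 0 := by
  -- Histories of length `t` take finitely many values, so the integral splits over the atoms `g ⁻¹'
  -- {v}`, on each of which `ψ` and `e` are constant.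
  set g : Ω → Fin t → Bool × Bool := fun ω i => (X i ω, Y i ω) with hgdef
  have hg : Measurable g := measurable_pi_lambda _ fun i => (hX i).prodMk (hY i)
  have hhist : ∀ ω, history X Y t ω = List.ofFn (g ω) := history_eq_ofFn t
  have hset : ∀ v, {ω | history X Y t ω = List.ofFn v} = g ⁻¹' {v} := fun v => by
    ext ω
    simp [hhist, List.ofFn_inj]
  have hms : ∀ v, MeasurableSet (g ⁻¹' {v}) := fun v => hg (measurableSet_singleton v)
  have hBs : MeasurableSet (B ⁻¹' {true}) := hB (measurableSet_singleton true)
  have hBind : ∀ ω, ((B ω).toNat : ℝ) = (B ⁻¹' {true}).indicator (fun _ => (1 : ℝ)) ω := fun ω => by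
    cases h : B ω <;> simp [h]
  have hBi : Integrable (fun ω => ((B ω).toNat : ℝ)) P := by
    simp_rw [hBind]
    exact (integrable_const 1).indicator hBs
  have hzero : ∀ v, ∫ ω in g ⁻¹' {v},
      ψ (history X Y t ω) * (((B ω).toNat : ℝ) - e (history X Y t ω)) ∂P = 0 := fun v => by
    have h1 : ∫ ω in g ⁻¹' {v},
        ψ (history X Y t ω) * (((B ω).toNat : ℝ) - e (history X Y t ω)) ∂P =
        ∫ ω in g ⁻¹' {v}, ψ (List.ofFn v) * (((B ω).toNat : ℝ) - e (List.ofFn v)) ∂P :=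
      setIntegral_congr_fun (hms v) fun ω hω => by
        have : g ω = v := hω
        simp only [hhist, this]
    have h2 := hlaw (List.ofFn v)
    rw [ofPred_and, hset] at h2
    have h3 : ∫ ω in g ⁻¹' {v}, ((B ω).toNat : ℝ) ∂P = P.real (g ⁻¹' {v} ∩ {ω | B ω = true}) := by
      simp_rw [hBind]
      rw [setIntegral_indicator hBs]
      simp [preimage]
    rw [h1, integral_const_mul, integral_sub hBi.integrableOn (integrable_const _), h3, h2]
    simp [mul_comm]
  have hint : ∀ v, IntegrableOn
      (fun ω => ψ (history X Y t ω) * (((B ω).toNat : ℝ) - e (history X Y t ω))) (g ⁻¹' {v}) P := by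
    intro v
    refine IntegrableOn.congr_fun (f := fun ω => ψ (List.ofFn v) * (((B ω).toNat : ℝ) -
      e (List.ofFn v))) ((hBi.sub (integrable_const _)).const_mul _).integrableOn
      (fun ω hω => ?_) (hms v)
    have : g ω = v := hω
    simp only [hhist, this]
  rw [← setIntegral_univ, ← preimage_univ (f := g), ← iUnion_of_singleton, preimage_iUnion,
    integral_iUnion_fintype hms (fun v w hvw => Disjoint.preimage g (by simpa using hvw)) hint]
  exact Finset.sum_eq_zero fun v _ => hzero v

/-- If `B t` is Bernoulli with parameter `e h` given the history `h`, for every `t`, then the averages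
of the differences `B t - e` tend to zero. -/
lemma ae_tendsto_average_sub (hX : ∀ t, Measurable (X t)) (hY : ∀ t, Measurable (Y t))
    (f : Bool × Bool → Bool) {e : List (Bool × Bool) → ℝ} (he : ∀ h, e h ∈ Icc (0 : ℝ) 1)
    (hlaw : ∀ t h, P.real {ω | history X Y t ω = h ∧ f (X t ω, Y t ω) = true} =
      e h * P.real {ω | history X Y t ω = h}) :
    ∀ᵐ ω ∂P, Tendsto (fun n : ℕ => (∑ i ∈ Finset.range n,
      (((f (X i ω, Y i ω)).toNat : ℝ) - e (history X Y i ω))) / n) atTop (𝓝 0) := by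
  have hfm : ∀ t, Measurable fun ω => f (X t ω, Y t ω) := fun t =>
    (measurable_of_finite f).comp ((hX t).prodMk (hY t))
  refine ae_tendsto_average_zero (fun n => ?_) (fun n ω => ?_) fun n => ?_
  · exact ((measurable_of_finite fun b : Bool => (b.toNat : ℝ)).comp (hfm n)).sub
      (measurable_comp_history hX hY n e)
  · have := he (history X Y n ω)
    rw [abs_le]
    cases f (X n ω, Y n ω) <;> simp <;> constructor <;> linarith [this.1, this.2]
  -- The partial sum is recovered from the history: entry `i` gives the value and the first `i`
  -- entries give its compensator. The default is never read, since `i < n`.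
  · rw [← integral_comp_history_mul_sub hX hY n (hfm n) (hlaw n) fun h =>
      ∑ i ∈ Finset.range n, (((f (h.getD i default)).toNat : ℝ) - e (h.take i))]
    congr 1 with ω
    congr 1
    refine Finset.sum_congr rfl fun i hi => ?_
    have hi' := Finset.mem_range.1 hi
    rw [history_take hi'.le]
    congr 4
    simp [history, hi']

end History

/-! ### Empirical averages of decisions -/

section Average

lemma coe_avgDecision_map (f : ℕ → Bool) (t : ℕ) :
    (avgDecision ((List.range t).map f) : ℝ) = (∑ i ∈ Finset.range t, ((f i).toNat : ℝ)) / t := by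
  have : (((List.range t).map f).count true : ℝ) = ∑ i ∈ Finset.range t, ((f i).toNat : ℝ) := by
    induction t with
    | zero => simp
    | succ t ih =>
      rw [List.range_succ, List.map_append, List.count_append, Finset.sum_range_succ, ← ih]
      cases h : f t <;> simp [h]
  simp [avgDecision, this]

/-- One extra entry changes the average by `O(1 / t)`. It is needed because the shield's estimate
includes the current decision, and both of its possible values enter the release probability. -/
lemma tendsto_avgDecision_append {f : ℕ → Bool} {p : ℝ} (x : Bool)
    (h : Tendsto (fun t : ℕ => (∑ i ∈ Finset.range t, ((f i).toNat : ℝ)) / t) atTop (𝓝 p)) :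
    Tendsto (fun t : ℕ => (avgDecision ((List.range t).map f ++ [x]) : ℝ)) atTop (𝓝 p) := by
  have hx : ∀ t : ℕ, (avgDecision ((List.range t).map f ++ [x]) : ℝ) =
      (∑ i ∈ Finset.range t, ((f i).toNat : ℝ)) / t * ((t : ℝ) / (t + 1)) +
        (x.toNat : ℝ) * (1 / ((t : ℝ) + 1)) := by
    intro t
    have h1 : (List.range t).map f ++ [x] =
        (List.range (t + 1)).map (fun i => if i < t then f i else x) := by
      rw [List.range_succ, List.map_append]
      simp only [List.map_cons, List.map_nil, lt_irrefl, if_false]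
      congr 1
      exact List.map_congr_left fun i hi => by simp [List.mem_range.1 hi]
    rw [h1, coe_avgDecision_map, Finset.sum_range_succ]
    have h2 : ∑ i ∈ Finset.range t, (((if i < t then f i else x).toNat : ℕ) : ℝ) =
        ∑ i ∈ Finset.range t, ((f i).toNat : ℝ) :=
      Finset.sum_congr rfl fun i hi => by simp [Finset.mem_range.1 hi]
    rw [h2]
    rcases eq_or_ne t 0 with rfl | ht
    · simp
    · have : (t : ℝ) ≠ 0 := by exact_mod_cast ht
      simp
      field_simp
  simp_rw [hx]
  have := (h.mul (tendsto_natCast_div_add_atTop (1 : ℝ))).add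
    (tendsto_one_div_add_atTop_nhds_zero_nat.const_mul (x.toNat : ℝ))
  simpa using this

end Average

/-! ### The conditional law of the released decision -/

section Release

variable {Ω : Type*} [MeasurableSpace Ω] {P : Measure Ω} [IsProbabilityMeasure P]
  {p : unitInterval} {S : ProbabilisticShield} {X Y : ℕ → Ω → Bool}

/-- The probability of releasing `1` given the history `h`. -/
noncomputable def releaseProb (p : unitInterval) (S : ProbabilisticShield)
    (h : List (Bool × Bool)) : ℝ :=
  p * (1 - S h true) + (1 - p) * S h false

lemma releaseProb_mem_Icc (h : List (Bool × Bool)) : releaseProb p S h ∈ Icc (0 : ℝ) 1 := by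
  have hp := p.2
  have h1 := (S h true).2
  have h2 := (S h false).2
  have h3 := mul_nonneg hp.1 (sub_nonneg.2 h1.2)
  have h4 := mul_nonneg (sub_nonneg.2 hp.2) h2.1
  have h5 := mul_nonneg hp.1 h1.1
  have h6 := mul_nonneg (sub_nonneg.2 hp.2) (sub_nonneg.2 h2.2)
  rw [releaseProb]
  constructor <;> linarith

/-- A released `1` is either an unflipped `1` or a flipped `0`; the two disjoint cases are weighed
by the laws of the decision and of the intervention. -/
lemma IsShieldedProcess.release_law (hXY : IsShieldedProcess P p S X Y) (t : ℕ)
    (h : List (Bool × Bool)) :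
    P.real {ω | history X Y t ω = h ∧ release (X t ω) (Y t ω) = true} =
      releaseProb p S h * P.real {ω | history X Y t ω = h} := by
  have hX : ∀ x, MeasurableSet {ω | X t ω = x} := fun x =>
    hXY.measurable_decision t (measurableSet_singleton x)
  have hY : ∀ y, MeasurableSet {ω | Y t ω = y} := fun y =>
    hXY.measurable_intervention t (measurableSet_singleton y)
  have e1 := measureReal_inter_add_sdiff (μ := P) (s := {ω | history X Y t ω = h}) (hX true)
  have e2 := measureReal_inter_add_sdiff (μ := P)
    (s := {ω | history X Y t ω = h ∧ release (X t ω) (Y t ω) = true}) (hX true)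
  have e3 := measureReal_inter_add_sdiff (μ := P)
    (s := {ω | history X Y t ω = h ∧ X t ω = true}) (hY true)
  have s1 : {ω | history X Y t ω = h} ∩ {ω | X t ω = true} =
      {ω | history X Y t ω = h ∧ X t ω = true} := rfl
  have s2 : {ω | history X Y t ω = h} \ {ω | X t ω = true} =
      {ω | history X Y t ω = h ∧ X t ω = false} := by ext; simp
  have s3 : {ω | history X Y t ω = h ∧ release (X t ω) (Y t ω) = true} ∩ {ω | X t ω = true} =
      {ω | history X Y t ω = h ∧ X t ω = true} \ {ω | Y t ω = true} := by
    ext ω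
    cases hx : X t ω <;> cases hy : Y t ω <;> simp [release, hx, hy]
  have s4 : {ω | history X Y t ω = h ∧ release (X t ω) (Y t ω) = true} \ {ω | X t ω = true} =
      {ω | history X Y t ω = h ∧ X t ω = false ∧ Y t ω = true} := by
    ext ω
    cases hx : X t ω <;> cases hy : Y t ω <;> simp [release, hx, hy]
  have s5 : {ω | history X Y t ω = h ∧ X t ω = true} ∩ {ω | Y t ω = true} =
      {ω | history X Y t ω = h ∧ X t ω = true ∧ Y t ω = true} := by
    ext ω
    simp [and_assoc]
  rw [s1, s2] at e1
  rw [s3, s4] at e2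
  rw [s5, hXY.intervention_law] at e3
  rw [hXY.intervention_law] at e2
  rw [hXY.decision_law] at e1 e3
  have e4 : P.real {ω | history X Y t ω = h ∧ X t ω = false} =
    (1 - p) * P.real {ω | history X Y t ω = h} := by linarith
  rw [e4] at e2
  rw [releaseProb]
  linear_combination e3 - e2

end Release

end EnergyShield

open EnergyShield

/-! ### Conclusion -/

theorem mainTheorem8 {Ω : Type*} [MeasurableSpace Ω] (P : Measure Ω) [IsProbabilityMeasure P]
    (p μstar : unitInterval) (ζ : unitInterval → EnergyShield.EnergyFunction)
    (hζ : ∀ q : unitInterval, ((ζ q).energy μstar : ℝ) =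
      if q < μstar then ((μstar : ℝ) - q) / (1 - q) else ((q : ℝ) - μstar) / q)
    (hpivot : ∀ q : unitInterval, μstar ∈ Set.uIcc q (ζ q).pivot)
    (first : Bool → unitInterval) (X Y : ℕ → Ω → Bool)
    (hXY : EnergyShield.IsShieldedProcess P p (EnergyShield.adaptiveShield ζ first) X Y) :
    ∀ᵐ ω ∂P, Tendsto (fun t : ℕ => EnergyShield.fairness X Y t ω) atTop (𝓝 (μstar : ℝ)) := by
  obtain ⟨hm0, hm1⟩ := target_mem_Ioo hζ hpivot
  have hX := hXY.measurable_decision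
  have hY := hXY.measurable_intervention
  filter_upwards [ae_tendsto_average_sub (P := P) hX hY (fun a => a.1) (e := fun _ => (p : ℝ))
    (fun _ => p.2) hXY.decision_law, ae_tendsto_average_sub (P := P) hX hY
    (fun a => release a.1 a.2) (fun h => releaseProb_mem_Icc (p := p) h) hXY.release_law]
    with ω hω1 hω2
  have hp : Tendsto (fun t : ℕ => (∑ i ∈ Finset.range t, ((X i ω).toNat : ℝ)) / t) atTop
      (𝓝 (p : ℝ)) := by
    have := hω1.add_const (p : ℝ)
    rw [zero_add] at this
    refine this.congr' ?_
    filter_upwards [eventually_ge_atTop 1] with t ht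
    have : (t : ℝ) ≠ 0 := by positivity
    rw [Finset.sum_sub_distrib]
    simp
    field_simp
    ring
  set q : Bool → ℕ → unitInterval :=
    fun x t => avgDecision ((history X Y t ω).map (fun e => e.1) ++ [x]) with hq
  have hqt : ∀ x, Tendsto (fun t => (q x t : ℝ)) atTop (𝓝 (p : ℝ)) := fun x => by
    have := tendsto_avgDecision_append x hp
    simpa [hq, history, Function.comp_def] using this
  have hfair : ∀ t, fairness X Y t ω =
      (∑ i ∈ Finset.range t, ((release (X i ω) (Y i ω)).toNat : ℝ)) / t := fun t => by
    rw [fairness, history, List.map_map, ← coe_avgDecision_map]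
    rfl
  -- Only index `0` uses the arbitrary parameter `first`; the drift conditions are required from
  -- index `1` on.
  have hne : ∀ t, 1 ≤ t → history X Y t ω ≠ [] := fun t ht h => by
    have := history_length (X := X) (Y := Y) t ω
    rw [h, List.length_nil] at this
    omega
  -- The true weights `p` and `1 - p` are paired with target flips at the two hypothetical
  -- estimates. Both estimates tend to `p`, where the balance identity gives exactly `μstar`.
  set d : ℕ → ℝ := fun t => p * (1 - targetFlipTrue μstar (q true t)) +
    (1 - p) * targetFlipFalse μstar (q false t) with hd
  have hdt : Tendsto d atTop (𝓝 (μstar : ℝ)) := by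
    have h1 := ((continuous_targetFlipTrue hm0).tendsto p).comp (hqt true)
    have h2 := ((continuous_targetFlipFalse hm1).tendsto p).comp (hqt false)
    have := ((h1.const_sub 1).const_mul (p : ℝ)).add (h2.const_mul (1 - (p : ℝ)))
    rwa [targetFlip_balance hm0 hm1] at this
  simp_rw [hfair]
  refine tendsto_average_of_drift (fun i => by positivity)
    (fun i => by exact_mod_cast Bool.toNat_le _) hm0.le hm1.le hdt (fun t ht hM => ?_)
    (fun t ht hM => ?_) hω2
  · rw [← hfair] at hM
    have h1 := flipProb_true_le hm0 (hζ (q true t)) (hpivot _) hM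
    have h2 := le_flipProb_false hm1 (hζ (q false t)) (hpivot _) hM
    simp only [hd, releaseProb, adaptiveShield, if_neg (hne t ht)]
    exact add_le_add (mul_le_mul_of_nonneg_left (sub_le_sub_left h1 1) p.2.1)
      (mul_le_mul_of_nonneg_left h2 (sub_nonneg.2 p.2.2))
  · rw [← hfair] at hM
    have h1 := le_flipProb_true hm0 (hζ (q true t)) (hpivot _) hM
    have h2 := flipProb_false_le hm1 (hζ (q false t)) (hpivot _) hM
    simp only [hd, releaseProb, adaptiveShield, if_neg (hne t ht)]
    exact add_le_add (mul_le_mul_of_nonneg_left (sub_le_sub_left h1 1) p.2.1)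
      (mul_le_mul_of_nonneg_left h2 (sub_nonneg.2 p.2.2))
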